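/- Let $K,N$ be natural numbers, let $\mathcal A_1,\dots,\mathcal A_K\subseteq[N]$, and let $\mathbb F_q$ be a finite field. A (distributed multi-user secret sharing) scheme with storage size $M\ge 1$ and message lengths $r_1,\dots,r_K\in\{0,1,2,\dots\}$ consists of a randomized encoder, which assigns to each tuple of messages $(w_1,\dots,w_K)\in\prod_{k}\mathbb F_q^{r_k}$ a probability distribution on the storage contents $(y_1,\dots,y_N)\in(\mathbb F_q^{M})^N$, and, for each user $k\in[K]$, a decoding function $\theta_k:(\mathbb F_q^M)^{\mathcal A_k}\to\mathbb F_q^{r_k}$. Let the messages $W_1,\dots,W_K$ be independent with $W_k$ uniform on $\mathbb F_q^{r_k}$, let $Y=(Y_1,\dots,Y_N)$ be the resulting random storage contents, and put $Y_{\mathcal A_k}=(Y_n)_{n\in\mathcal A_k}$. The $k$-th rate is $R_k=r_k/M$, the $k$-th error probability is $\mathbb P(\theta_k(Y_{\mathcal A_k})\ne W_k)$, and the scheme is private if $H(W_{\tilde k})=H(W_{\tilde k}\mid Y_{\mathcal A_k})$ for all $k\neq\tilde k$ in $[K]$, where $H$ is Shannon entropy. A tuple $(R_1,\dots,R_K)\in\mathbb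 R^K$ is achievable if there is a sequence of private schemes, all with rates exactly $(R_1,\dots,R_K)$, whose storage sizes tend to infinity and whose error probabilities all tend to $0$. The capacity region $\mathcal C\subseteq\mathbb R^K$ is the closure of the set of achievable tuples. Then $\mathcal C$ is the convex hull of the set of all $(R_1,\dots,R_K)\in[0,\infty)^K$ such that $$R_k\le\min_{\tilde k\ne k}|\mathcal A_k\setminus\mathcal A_{\tilde k}|\quad\text{for all }k\in[K],\qquad \sum_{i\in\mathcal S}R_i\le\Big|\bigcup_{i\in\mathcal S}\mathcal A_i\Big|\quad\text{for all }\mathcal S\subseteq[K]$$ (the first condition being void if $K=1$), and this set is convex, so that $\mathcal C$ is equal to it. -/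

import Mathlib

open Filter Topology

namespace DMUSS

noncomputable section

/-- Shannon entropy `H(X)`, in nats, of a random variable `X` with finitely many values. -/
def entropy {Ω α : Type*} [Fintype α] (P : PMF Ω) (X : Ω → α) : ℝ :=
  ∑ x, Real.negMulLog ((P.map X) x).toReal

/-- Conditional Shannon entropy `H(X | Y) = ∑ y, P(Y = y) H(X | Y = y)`, in nats. Values `y` of
probability zero contribute zero. -/
def condEntropy {Ω α β : Type*} [Fintype α] [Fintype β]
    (P : PMF Ω) (X : Ω → α) (Y : Ω → β) : ℝ :=
  ∑ y, ((P.map Y) y).toReal *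
    ∑ x, Real.negMulLog (((P.map fun ω => (X ω, Y ω)) (x, y)).toReal / ((P.map Y) y).toReal)

variable {K N : ℕ}

/-- A tuple of secret messages; the message of user `k` consists of `r k` symbols of `F`. -/
abbrev Messages (F : Type*) (r : Fin K → ℕ) : Type _ := (k : Fin K) → Fin (r k) → F

/-- The contents of the `N` storage nodes, each of which stores `M` symbols of `F`. -/
abbrev Storage (F : Type*) (N M : ℕ) : Type _ := Fin N → Fin M → F

/-- What a user with access set `B` reads from the storage nodes. -/
def view {F : Type*} {M : ℕ} (B : Finset (Fin N)) (y : Storage F N M) : B → Fin M → F :=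
  fun n => y n

/-- A scheme for storage size `M` and message lengths `r`. The master node may use private
randomness: for given messages, `enc` is the law of the stored contents. User `k` decodes by a
function of the contents of the storage nodes in `A k`. -/
structure Scheme (A : Fin K → Finset (Fin N)) (F : Type*) (M : ℕ) (r : Fin K → ℕ) where
  enc : Messages F r → PMF (Storage F N M)
  dec : (k : Fin K) → (A k → Fin M → F) → (Fin (r k) → F)

namespace Scheme

variable {A : Fin K → Finset (Fin N)} {F : Type*} [Fintype F] [Nonempty F]
  {M : ℕ} {r : Fin K → ℕ}

/-- The joint law of messages and stored contents. The messages are independent, each of them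
uniformly distributed. -/
def joint (s : Scheme A F M r) : PMF (Messages F r × Storage F N M) :=
  (PMF.uniformOfFintype (Messages F r)).bind fun w => (s.enc w).map fun y => (w, y)

/-- The probability that user `k` decodes its own message wrongly. -/
def errorProb (s : Scheme A F M r) (k : Fin K) : ℝ :=
  (s.joint.toOuterMeasure {p | s.dec k (view (A k) p.2) ≠ p.1 k}).toReal

/-- Perfect privacy: `H(W_l) = H(W_l | Y_{A_k})` for all users `k ≠ l`. -/
def IsPrivate (s : Scheme A F M r) : Prop :=
  ∀ k l : Fin K, k ≠ l →
    entropy s.joint (fun p => p.1 l) =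
      condEntropy s.joint (fun p => p.1 l) (fun p => view (A k) p.2)

end Scheme

/-- A rate tuple is achievable if there is a sequence of perfectly private schemes with exactly
these rates, with storage sizes tending to infinity and error probabilities tending to zero. -/
def Achievable (A : Fin K → Finset (Fin N)) (F : Type*) [Fintype F] [Nonempty F]
    (R : Fin K → ℝ) : Prop :=
  ∃ (M : ℕ → ℕ) (r : ℕ → Fin K → ℕ) (s : (j : ℕ) → Scheme A F (M j) (r j)),
    (∀ j, 0 < M j) ∧ Tendsto M atTop atTop ∧
    (∀ j k, (r j k : ℝ) / (M j : ℝ) = R k) ∧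
    (∀ k, Tendsto (fun j => (s j).errorProb k) atTop (𝓝 0)) ∧
    ∀ j, (s j).IsPrivate

/-- The capacity region: the closure of the set of achievable rate tuples. -/
def capacityRegion (A : Fin K → Finset (Fin N)) (F : Type*) [Fintype F] [Nonempty F] :
    Set (Fin K → ℝ) :=
  closure {R | Achievable A F R}

/-- The nonnegative tuples with `R_k ≤ min_{l ≠ k} |A_k \ A_l|` for all `k` that satisfy the cutset
condition `∑_{i ∈ S} R_i ≤ |⋃_{i ∈ S} A_i|` for all `S`. -/
def rateRegion (A : Fin K → Finset (Fin N)) : Set (Fin K → ℝ) :=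
  {R | (∀ k, 0 ≤ R k) ∧
    (∀ k l : Fin K, l ≠ k → R k ≤ ((A k \ A l).card : ℝ)) ∧
    ∀ S : Finset (Fin K), ∑ i ∈ S, R i ≤ ((S.biUnion A).card : ℝ)}

end

end DMUSS

/-!
The capacity region is sandwiched between the rate region and itself: achievable tuples satisfy the
inequalities (`Achievable.mem_rateRegion`), the region is closed, and every point of it is a limit
of achievable tuples (`rateRegion_subset_capacityRegion`). Its convexity is immediate, as it is cut
out by linear inequalities.

*Converse.* Both families of inequalities are instances of one counting bound, `prob_guess_le`: if
every value of `X` has conditional probability at most `c` given `Z`, then `X` is guessed correctly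
from `Z` and a further variable `T` with probability at most `c` times the number of values of `T`.
For the cutset inequality, `Z` is constant, `X` consists of the messages of the users in `S` and `T`
is what they read together. For `R_k ≤ |A_k \ A_l|`, `X` is the message of user `k`, `Z` is what
user `l` reads, and `T` is the content of the nodes in `A_k \ A_l`; privacy enters through
`entropy_eq_condEntropy_iff`, the equality case of Jensen's inequality, which makes `X` and `Z`
independent. A strictly violated inequality keeps the probability of success at most `1 / 2`.

*Achievability.* Rational points of the region are achieved without errors. Let the contents be a
uniform vector over a large field `E` and let the messages be linear functions of it, where the
coefficients used by user `k` are supported on `A_k`. The encoder samples from the uniform law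
conditioned on the messages. This works if the linear map is onto and, for `k ≠ l`, its `k`-th
component is onto already on the vectors vanishing on `A_l` (`exists_decoding_matrix`). Generic
coefficients have both properties: the first because Hall's theorem turns the cutset inequalities
into a matching of message symbols with storage symbols, which makes a determinant a nonzero
polynomial, the second because `A_k \ A_l` has enough storage symbols. A field of `|F| ^ n` elements
with `n` large has a point at which none of these polynomials vanishes, and its elements are stored
as `n` symbols of `F`.
-/

namespace DMUSS

noncomputable section

/-! ### Finite probability and entropy -/

/-- The probability `P(s)` of an event `s`, as a real number. -/
def prob {Ω : Type*} (P : PMF Ω) (s : Set Ω) : ℝ := (P.toOuterMeasure s).toReal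

section Prob

variable {Ω α β τ : Type*} (P : PMF Ω)

lemma prob_nonneg (s : Set Ω) : 0 ≤ prob P s := ENNReal.toReal_nonneg

lemma toReal_map_apply (X : Ω → α) (x : α) :
    ((P.map X) x).toReal = prob P {ω | X ω = x} := by
  rw [prob, ← PMF.toOuterMeasure_apply_singleton, PMF.toOuterMeasure_map_apply]
  rfl

lemma prob_map (X : Ω → α) (s : Set α) : prob (P.map X) s = prob P (X ⁻¹' s) := by
  rw [prob, prob, PMF.toOuterMeasure_map_apply]

lemma prob_univ : prob P Set.univ = 1 := by
  rw [prob, (P.toOuterMeasure_apply_eq_one_iff _).2 (Set.subset_univ _)]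
  simp

lemma entropy_eq [Fintype α] (X : Ω → α) :
    entropy P X = ∑ x, Real.negMulLog (prob P {ω | X ω = x}) := by
  simp only [entropy, toReal_map_apply]

lemma condEntropy_eq [Fintype α] [Fintype β] (X : Ω → α) (Y : Ω → β) :
    condEntropy P X Y = ∑ x, ∑ y, prob P {ω | Y ω = y} *
      Real.negMulLog (prob P ({ω | X ω = x} ∩ {ω | Y ω = y}) / prob P {ω | Y ω = y}) := by
  simp only [condEntropy, toReal_map_apply, Prod.mk.injEq, Set.ofPred_and, Finset.mul_sum]
  exact Finset.sum_comm

variable [Fintype Ω]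

open Classical in
lemma prob_eq_sum (s : Set Ω) : prob P s = ∑ ω, if ω ∈ s then (P ω).toReal else 0 := by
  rw [prob, PMF.toOuterMeasure_apply_fintype, ENNReal.toReal_sum]
  · refine Finset.sum_congr rfl fun ω _ => ?_
    by_cases h : ω ∈ s <;> simp [h]
  · intro ω _
    by_cases h : ω ∈ s <;> simp [h, P.apply_ne_top]

lemma prob_mono {s t : Set Ω} (h : s ⊆ t) : prob P s ≤ prob P t := by
  classical
  rw [prob_eq_sum, prob_eq_sum]
  refine Finset.sum_le_sum fun ω _ => ?_
  by_cases h1 : ω ∈ s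
  · simp [h1, h h1]
  · by_cases h2 : ω ∈ t <;> simp [h1, h2]

lemma prob_union_le (s t : Set Ω) : prob P (s ∪ t) ≤ prob P s + prob P t := by
  classical
  simp only [prob_eq_sum, ← Finset.sum_add_distrib]
  refine Finset.sum_le_sum fun ω _ => ?_
  by_cases h1 : ω ∈ s <;> by_cases h2 : ω ∈ t <;> simp [h1, h2]

lemma prob_biUnion_le (S : Finset τ) (s : τ → Set Ω) :
    prob P (⋃ i ∈ S, s i) ≤ ∑ i ∈ S, prob P (s i) := by
  classical
  induction S using Finset.induction_on with
  | empty => simp [prob]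
  | insert a S ha ih =>
    rw [Finset.set_biUnion_insert, Finset.sum_insert ha]
    exact (prob_union_le P _ _).trans (by linarith)

lemma prob_add_prob_compl (s : Set Ω) : prob P s + prob P sᶜ = 1 := by
  classical
  rw [← prob_univ P]
  simp only [prob_eq_sum, ← Finset.sum_add_distrib]
  refine Finset.sum_congr rfl fun ω _ => ?_
  by_cases h1 : ω ∈ s <;> simp [h1]

/-- The law of total probability. -/
lemma prob_eq_sum_inter [Fintype β] (s : Set Ω) (Y : Ω → β) :
    prob P s = ∑ y, prob P (s ∩ {ω | Y ω = y}) := by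
  classical
  simp only [prob_eq_sum]
  rw [Finset.sum_comm]
  refine Finset.sum_congr rfl fun ω _ => ?_
  by_cases h1 : ω ∈ s <;> simp [h1]

lemma sum_prob_eq_one [Fintype β] (Y : Ω → β) : ∑ y, prob P {ω | Y ω = y} = 1 := by
  rw [← prob_univ P, prob_eq_sum_inter P Set.univ Y]
  simp

lemma prob_uniformOfFintype [Nonempty Ω] (s : Set Ω) :
    prob (PMF.uniformOfFintype Ω) s = (Nat.card s : ℝ) / Fintype.card Ω := by
  classical
  rw [prob, PMF.toOuterMeasure_uniformOfFintype_apply, ENNReal.toReal_div]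
  simp

/-- Side information cannot help a guesser by more than its number of values: if every value of
`X` has conditional probability at most `c` given `Z`, then a guess of `X` from `Z` and a further
variable `T` is right with probability at most `c` times the number of values of `T`. -/
lemma prob_guess_le {ζ : Type*} [Fintype τ] [Fintype ζ]
    (X : Ω → α) (Z : Ω → ζ) (T : Ω → τ) (D : ζ → τ → α) (c : ℝ)
    (h : ∀ x z, prob P ({ω | X ω = x} ∩ {ω | Z ω = z}) ≤ c * prob P {ω | Z ω = z}) :
    prob P {ω | X ω = D (Z ω) (T ω)} ≤ c * Fintype.card τ := by
  calc prob P {ω | X ω = D (Z ω) (T ω)}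
      = ∑ t, prob P ({ω | X ω = D (Z ω) (T ω)} ∩ {ω | T ω = t}) := prob_eq_sum_inter _ _ _
    _ ≤ ∑ t, prob P {ω | X ω = D (Z ω) t} := by
        refine Finset.sum_le_sum fun t _ => prob_mono P ?_
        rintro ω ⟨h1, h2⟩
        simp only [Set.mem_ofPred_eq] at h1 h2 ⊢
        rw [h1, h2]
    _ ≤ ∑ _t : τ, c := by
        refine Finset.sum_le_sum fun t _ => ?_
        rw [prob_eq_sum_inter P _ Z]
        calc ∑ z, prob P ({ω | X ω = D (Z ω) t} ∩ {ω | Z ω = z})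
            ≤ ∑ z, c * prob P {ω | Z ω = z} := by
              refine Finset.sum_le_sum fun z _ => (prob_mono P ?_).trans (h (D z t) z)
              rintro ω ⟨h1, h2⟩
              simp only [Set.mem_ofPred_eq] at h1 h2
              exact ⟨by simp [h1, h2], h2⟩
          _ = c := by rw [← Finset.mul_sum, sum_prob_eq_one, mul_one]
    _ = c * Fintype.card τ := by simp [mul_comm]

/-- Entropy is unchanged by conditioning exactly when the variables are independent. -/
lemma entropy_eq_condEntropy_iff [Fintype α] [Fintype β] (X : Ω → α) (Y : Ω → β) :
    entropy P X = condEntropy P X Y ↔ ∀ x y, prob P ({ω | X ω = x} ∩ {ω | Y ω = y}) =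
      prob P {ω | X ω = x} * prob P {ω | Y ω = y} := by
  rw [entropy_eq, condEntropy_eq]
  have hnull : ∀ x y, prob P {ω | Y ω = y} = 0 →
      prob P ({ω | X ω = x} ∩ {ω | Y ω = y}) = 0 := fun x y h =>
    le_antisymm (h ▸ prob_mono P Set.inter_subset_right) (prob_nonneg _ _)
  have havg : ∀ x, ∑ y, prob P {ω | Y ω = y} • (prob P ({ω | X ω = x} ∩ {ω | Y ω = y}) /
      prob P {ω | Y ω = y}) = prob P {ω | X ω = x} := by
    intro x
    rw [prob_eq_sum_inter P _ Y]
    refine Finset.sum_congr rfl fun y _ => ?_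
    by_cases h : prob P {ω | Y ω = y} = 0
    · simp [h, hnull x y h]
    · simp [mul_div_cancel₀ _ h]
  have hmem : ∀ x, ∀ y ∈ (Finset.univ : Finset β),
      prob P ({ω | X ω = x} ∩ {ω | Y ω = y}) / prob P {ω | Y ω = y} ∈ Set.Ici (0 : ℝ) :=
    fun x y _ => div_nonneg (prob_nonneg _ _) (prob_nonneg _ _)
  have hone := sum_prob_eq_one P Y
  have hjensen : ∀ x, ∑ y, prob P {ω | Y ω = y} * Real.negMulLog
      (prob P ({ω | X ω = x} ∩ {ω | Y ω = y}) / prob P {ω | Y ω = y}) ≤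
      Real.negMulLog (prob P {ω | X ω = x}) := by
    intro x
    have := Real.concaveOn_negMulLog.le_map_sum (fun y _ => prob_nonneg P {ω | Y ω = y})
      hone (hmem x)
    rw [havg x] at this
    simpa only [smul_eq_mul] using this
  rw [eq_comm, Finset.sum_eq_sum_iff_of_le fun x _ => hjensen x]
  refine ⟨fun h x y => ?_, fun h x _ => ?_⟩
  · by_cases hy : prob P {ω | Y ω = y} = 0
    · simp [hy, hnull x y hy]
    · have h1 := (Real.strictConcaveOn_negMulLog.map_sum_eq_iff'
        (fun y _ => prob_nonneg P {ω | Y ω = y}) hone (hmem x)).1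
        (by rw [havg x]; simpa only [smul_eq_mul] using (h x (Finset.mem_univ x)).symm)
        y (Finset.mem_univ y) hy
      rw [havg x, div_eq_iff hy] at h1
      exact h1
  · calc _ = ∑ y, prob P {ω | Y ω = y} * Real.negMulLog (prob P {ω | X ω = x}) := by
          refine Finset.sum_congr rfl fun y _ => ?_
          by_cases hy : prob P {ω | Y ω = y} = 0
          · simp [hy]
          · rw [h, mul_div_cancel_right₀ _ hy]
      _ = _ := by rw [← Finset.sum_mul, hone, one_mul]

/-- If the joint law of `X` and `Y` does not depend on the value of `X`, then `X` and `Y` are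
independent (and `X` is uniform). -/
lemma indep_of_joint_const [Fintype α] [Fintype β] (X : Ω → α) (Y : Ω → β)
    (h : ∀ x x' y, prob P ({ω | X ω = x} ∩ {ω | Y ω = y}) =
      prob P ({ω | X ω = x'} ∩ {ω | Y ω = y})) (x : α) (y : β) :
    prob P ({ω | X ω = x} ∩ {ω | Y ω = y}) = prob P {ω | X ω = x} * prob P {ω | Y ω = y} := by
  have hY : ∀ y, prob P {ω | Y ω = y} =
      Fintype.card α * prob P ({ω | X ω = x} ∩ {ω | Y ω = y}) := by
    intro y
    rw [prob_eq_sum_inter P _ X]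
    simp_rw [Set.inter_comm {ω | Y ω = y}, h _ x y]
    simp
  have hX : Fintype.card α * prob P {ω | X ω = x} = 1 := by
    rw [prob_eq_sum_inter P _ Y, Finset.mul_sum, ← sum_prob_eq_one P Y]
    exact Finset.sum_congr rfl fun y _ => (hY y).symm
  rw [hY, ← mul_assoc, mul_comm (prob P {ω | X ω = x}), hX, one_mul]

end Prob

/-! ### The converse and the shape of the region -/

section Converse

lemma card_view {N M : ℕ} {F : Type*} [Fintype F] (B : Finset (Fin N)) :
    Fintype.card (B → Fin M → F) = Fintype.card F ^ (M * B.card) := by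
  simp [pow_mul]

variable {K N : ℕ} {A : Fin K → Finset (Fin N)} {F : Type*} [Fintype F] [Nonempty F]
  {M : ℕ} {r : Fin K → ℕ}

lemma Scheme.joint_map_fst (s : Scheme A F M r) :
    s.joint.map Prod.fst = PMF.uniformOfFintype (Messages F r) := by
  rw [Scheme.joint, PMF.map_bind]
  simp only [PMF.map_comp]
  have : ∀ w : Messages F r, (s.enc w).map (Prod.fst ∘ fun y => (w, y)) = PMF.pure w := by
    intro w
    exact PMF.map_const _ _
  simp only [this, PMF.bind_pure]

/-- The messages of any set `S` of users are jointly uniform. -/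
lemma Scheme.prob_messages (s : Scheme A F M r) (S : Finset (Fin K)) (x : Messages F r) :
    prob s.joint {p | ∀ k ∈ S, p.1 k = x k} = ((Fintype.card F : ℝ) ^ ∑ k ∈ S, r k)⁻¹ := by
  classical
  have h0 : (Fintype.card F : ℝ) ≠ 0 := by exact_mod_cast Fintype.card_ne_zero
  have h : {p : Messages F r × Storage F N M | ∀ k ∈ S, p.1 k = x k} =
      Prod.fst ⁻¹' {w : Messages F r | ∀ k ∈ S, w k = x k} := rfl
  rw [h, ← prob_map, s.joint_map_fst, prob_uniformOfFintype]
  have hset : {w : Messages F r | ∀ k ∈ S, w k = x k} =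
      (Fintype.piFinset fun k => if k ∈ S then {x k} else Finset.univ : Set (Messages F r)) := by
    ext w
    simp only [Set.mem_ofPred_eq, Finset.mem_coe, Fintype.mem_piFinset]
    refine forall_congr' fun k => ?_
    by_cases hk : k ∈ S <;> simp [hk]
  rw [hset, Nat.card_coe_set_eq, Set.ncard_coe_finset,
    Fintype.card_piFinset, Fintype.card_pi]
  push_cast
  rw [← Finset.prod_div_distrib, ← Finset.prod_pow_eq_pow_sum, ← Finset.prod_inv_distrib,
    ← Finset.prod_subset (Finset.subset_univ S)]
  · refine Finset.prod_congr rfl fun k hk => ?_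
    simp [hk]
  · intro k _ hk
    simp [hk, h0]

lemma Scheme.prob_message (s : Scheme A F M r) (k : Fin K) (x : Fin (r k) → F) :
    prob s.joint {p | p.1 k = x} = ((Fintype.card F : ℝ) ^ r k)⁻¹ := by
  classical
  have := s.prob_messages {k} (Function.update (fun _ _ => Classical.arbitrary F) k x)
  simpa using this

/-- Counting bound for cutsets: the messages of the users in `S` are recovered from the nodes in
`⋃_{i ∈ S} A_i`, whose contents take only `|F| ^ (M |⋃_{i ∈ S} A_i|)` values. -/
lemma Scheme.one_sub_sum_errorProb_le (s : Scheme A F M r) (S : Finset (Fin K)) :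
    1 - ∑ k ∈ S, s.errorProb k ≤
      ((Fintype.card F : ℝ) ^ ∑ k ∈ S, r k)⁻¹ * (Fintype.card F : ℝ) ^ (M * (S.biUnion A).card) := by
  classical
  have hsub : ∀ k ∈ S, A k ⊆ S.biUnion A := fun k hk => Finset.subset_biUnion_of_mem A hk
  have hcompl := prob_add_prob_compl s.joint
    (⋃ k ∈ S, {p | s.dec k (view (A k) p.2) ≠ p.1 k})
  have hunion := prob_biUnion_le s.joint S fun k => {p | s.dec k (view (A k) p.2) ≠ p.1 k}
  have hguess := prob_guess_le s.joint (fun p (k : S) => p.1 k) (fun _ => ())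
    (fun p => view (S.biUnion A) p.2)
    (fun _ v k => s.dec k fun n => v ⟨n, hsub k k.2 n.2⟩)
    ((Fintype.card F : ℝ) ^ ∑ k ∈ S, r k)⁻¹ ?_
  · rw [card_view] at hguess
    push_cast at hguess
    refine le_trans ?_ hguess
    refine le_trans ?_ (prob_mono s.joint
      (s := (⋃ k ∈ S, {p | s.dec k (view (A k) p.2) ≠ p.1 k})ᶜ) ?_)
    · change prob s.joint _ ≤ ∑ k ∈ S, s.errorProb k at hunion
      linarith
    · intro p hp
      simp only [Set.mem_compl_iff, Set.mem_iUnion, not_exists, Set.mem_ofPred_eq, not_not] at hp ⊢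
      funext k
      exact (hp k k.2).symm
  · intro x _
    have h1 := s.prob_messages S
      (fun k => if hk : k ∈ S then x ⟨k, hk⟩ else fun _ => Classical.arbitrary F)
    have h2 : prob s.joint {p | () = ()} = 1 := by
      simpa using prob_univ s.joint
    rw [h2, mul_one, ← h1]
    refine prob_mono _ ?_
    rintro p ⟨hp, -⟩ k hk
    simp only [Set.mem_ofPred_eq] at hp
    simp only [hk, dif_pos, ← hp]

/-- Counting bound for privacy: the contents of the nodes in `A_l` say nothing about the message of
user `k`, who has to find it with the help of the nodes in `A_k \ A_l` alone. -/
lemma Scheme.IsPrivate.one_sub_errorProb_le {s : Scheme A F M r} (hs : s.IsPrivate)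
    {k l : Fin K} (hlk : l ≠ k) :
    1 - s.errorProb k ≤
      ((Fintype.card F : ℝ) ^ r k)⁻¹ * (Fintype.card F : ℝ) ^ (M * (A k \ A l).card) := by
  classical
  have hcompl := prob_add_prob_compl s.joint {p | s.dec k (view (A k) p.2) ≠ p.1 k}
  have hguess := prob_guess_le s.joint (fun p => p.1 k) (fun p => view (A l) p.2)
    (fun p => view (A k \ A l) p.2)
    (fun u v => s.dec k fun n => if hn : n.1 ∈ A l then u ⟨n, hn⟩
      else v ⟨n, Finset.mem_sdiff.2 ⟨n.2, hn⟩⟩)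
    ((Fintype.card F : ℝ) ^ r k)⁻¹ ?_
  · rw [card_view] at hguess
    push_cast at hguess
    refine le_trans ?_ hguess
    refine le_trans ?_ (prob_mono s.joint
      (s := {p | s.dec k (view (A k) p.2) ≠ p.1 k}ᶜ) ?_)
    · change s.errorProb k + _ = 1 at hcompl
      linarith
    · intro p hp
      simp only [Set.mem_compl_iff, Set.mem_ofPred_eq, not_not] at hp ⊢
      rw [← hp]
      congr 1
      funext n
      by_cases hn : n.1 ∈ A l <;> simp [hn, view]
  · intro x z
    rw [(entropy_eq_condEntropy_iff _ _ _).1 (hs l k hlk) x z, s.prob_message k x]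

/-- If a counting bound holds along a sequence of errors tending to zero, then at some index the
message length `a` does not exceed the storage `b`: otherwise each error is at least `1 / 2`. -/
lemma le_of_tendsto_of_counting_bound (hF : 2 ≤ Fintype.card F) {a b : ℕ → ℕ} {ε : ℕ → ℝ}
    (hε : Tendsto ε atTop (𝓝 0))
    (h : ∀ j, 1 - ε j ≤ ((Fintype.card F : ℝ) ^ a j)⁻¹ * (Fintype.card F : ℝ) ^ b j) :
    ∃ j, a j ≤ b j := by
  obtain ⟨j, hj⟩ := (hε.eventually (gt_mem_nhds (by norm_num : (0 : ℝ) < 1 / 2))).exists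
  refine ⟨j, ?_⟩
  by_contra hab
  have hF' : (2 : ℝ) ≤ Fintype.card F := by exact_mod_cast hF
  have hpos : (0 : ℝ) < (Fintype.card F : ℝ) ^ a j := by positivity
  have h1 := h j
  rw [inv_mul_eq_div, le_div_iff₀ hpos] at h1
  have h2 : (Fintype.card F : ℝ) ^ (b j + 1) ≤ (Fintype.card F : ℝ) ^ a j :=
    pow_le_pow_right₀ (by linarith) (by omega)
  rw [pow_succ] at h2
  have h3 : (0 : ℝ) < (Fintype.card F : ℝ) ^ b j := by positivity
  nlinarith

lemma Achievable.mem_rateRegion (hF : 2 ≤ Fintype.card F) {R : Fin K → ℝ}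
    (h : Achievable A F R) : R ∈ rateRegion A := by
  obtain ⟨M, r, s, hM, -, hR, herr, hpriv⟩ := h
  have hM' : ∀ j, (0 : ℝ) < M j := fun j => by exact_mod_cast hM j
  refine ⟨fun k => ?_, fun k l hlk => ?_, fun S => ?_⟩
  · rw [← hR 0 k]
    positivity
  · obtain ⟨j, hj⟩ := le_of_tendsto_of_counting_bound hF (herr k)
      fun j => (hpriv j).one_sub_errorProb_le hlk
    rw [← hR j k, div_le_iff₀ (hM' j), mul_comm]
    exact_mod_cast hj
  · have hsum : Tendsto (fun j => ∑ k ∈ S, (s j).errorProb k) atTop (𝓝 0) := by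
      simpa using tendsto_finsetSum S fun k _ => herr k
    obtain ⟨j, hj⟩ := le_of_tendsto_of_counting_bound hF hsum
      fun j => (s j).one_sub_sum_errorProb_le S
    simp only [← hR j]
    rw [← Finset.sum_div, div_le_iff₀ (hM' j), mul_comm]
    exact_mod_cast hj

end Converse

section Region

variable {K N : ℕ} (A : Fin K → Finset (Fin N))

lemma convex_rateRegion : Convex ℝ (rateRegion A) := by
  rintro x ⟨hx0, hx1, hx2⟩ y ⟨hy0, hy1, hy2⟩ a b ha hb hab
  refine ⟨fun k => ?_, fun k l hlk => ?_, fun S => ?_⟩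
  · have := hx0 k
    have := hy0 k
    simp only [Pi.add_apply, Pi.smul_apply, smul_eq_mul]
    positivity
  · exact (convex_Iic ((A k \ A l).card : ℝ)) (hx1 k l hlk) (hy1 k l hlk) ha hb hab
  · have := (convex_Iic (((S.biUnion A).card : ℝ))) (hx2 S) (hy2 S) ha hb hab
    simpa [Finset.mul_sum, Finset.sum_add_distrib] using this

lemma isClosed_rateRegion : IsClosed (rateRegion A) := by
  simp only [rateRegion, Set.ofPred_and, Set.ofPred_forall]
  refine .inter (isClosed_iInter fun k => isClosed_le (by fun_prop) (by fun_prop)) (.inter ?_ ?_)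
  · exact isClosed_iInter fun k => isClosed_iInter fun l => isClosed_iInter fun _ =>
      isClosed_le (by fun_prop) (by fun_prop)
  · exact isClosed_iInter fun S => isClosed_le (by fun_prop) (by fun_prop)

end Region

/-! ### Generic decoding matrices -/

section Algebra

/-- A nonzero polynomial over a field `k` has a non-root with coordinates in `E`, for every large
enough extension field `E`; how large depends on the polynomial only. -/
lemma exists_aeval_ne_zero {σ k : Type*} [Finite σ] [Field k] {P : MvPolynomial σ k} (hP : P ≠ 0)
    {E : Type*} [Field E] [Fintype E] [Algebra k E] (hE : P.totalDegree < Fintype.card E) :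
    ∃ x : σ → E, MvPolynomial.aeval x P ≠ 0 := by
  by_contra! h
  refine hP (MvPolynomial.map_injective (algebraMap k E) (algebraMap k E).injective ?_)
  rw [map_zero]
  refine MvPolynomial.eq_zero_of_eval_zero_at_prod_finset _ (fun _ => Finset.univ) (fun i => ?_)
    fun x _ => ?_
  · refine ((MvPolynomial.degreeOf_le_totalDegree _ i).trans ?_).trans_lt hE
    exact Finset.sup_mono (MvPolynomial.support_map_subset _ _)
  · rw [MvPolynomial.eval_map, ← h x]
    rfl

variable {ρ γ : Type*}

/-- The matrix of independent variables, with zeros outside the pattern `rel`. -/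
def genericMatrix (k : Type*) [CommSemiring k] (rel : ρ → γ → Prop) :
    Matrix ρ γ (MvPolynomial (ρ × γ) k) := by
  classical
  exact .of fun i j => if rel i j then MvPolynomial.X (i, j) else 0

/-- A square submatrix of a generic matrix is invertible if the pattern contains a matching of its
rows and columns. -/
lemma det_genericMatrix_submatrix_ne_zero (k : Type*) [Field k] {rel : ρ → γ → Prop} {ι : Type*}
    [Fintype ι] [DecidableEq ι] {e : ι → ρ} (he : e.Injective) {f : ι → γ}
    (hf : f.Injective) (h : ∀ i, rel (e i) (f i)) :
    ((genericMatrix k rel).submatrix e f).det ≠ 0 := by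
  classical
  intro h0
  -- Specialize the variables to the permutation matrix of the matching.
  let φ : MvPolynomial (ρ × γ) k →ₐ[k] k :=
    MvPolynomial.aeval fun p => if ∃ i, p = (e i, f i) then 1 else 0
  have h1 : φ.mapMatrix ((genericMatrix k rel).submatrix e f) = 1 := by
    ext i j
    by_cases hij : i = j
    · subst hij
      have : ∃ i', e i = e i' ∧ f i = f i' := ⟨i, rfl, rfl⟩
      simp [genericMatrix, h, φ, this]
    · have : ¬ ∃ i', e i = e i' ∧ f j = f i' := by
        rintro ⟨i', h1, h2⟩
        exact hij ((he h1).trans (hf h2).symm)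
      by_cases hr : rel (e i) (f j) <;> simp [genericMatrix, hr, φ, hij, this]
  have h2 := congrArg φ h0
  rw [AlgHom.map_det, h1] at h2
  simp at h2

/-- If a square submatrix of `C` is invertible, then every vector is attained on its rows by some
vector supported on its columns. -/
lemma exists_sum_mul_eq {E ι : Type*} [Field E] [Fintype ι] [DecidableEq ι] [Fintype γ]
    (C : Matrix ρ γ E) (e : ι → ρ) {f : ι → γ} (hf : f.Injective)
    (h : (C.submatrix e f).det ≠ 0) (w : ι → E) :
    ∃ z : γ → E, (∀ c ∉ Set.range f, z c = 0) ∧ ∀ i, ∑ c, C (e i) c * z c = w i := by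
  classical
  obtain ⟨v, hv⟩ := Matrix.mulVec_surjective_iff_isUnit.2
    ((Matrix.isUnit_iff_isUnit_det _).2 h.isUnit) w
  refine ⟨Function.extend f v 0, fun c hc => ?_, fun i => ?_⟩
  · rw [Function.extend_apply' _ _ _ hc]
    rfl
  · rw [← hv]
    refine (Fintype.sum_of_injective f hf _ _ (fun c hc => ?_) fun j => ?_).symm
    · rw [Function.extend_apply' _ _ _ hc]
      simp
    · rw [hf.extend_apply]
      rfl

variable {K N : ℕ} {A : Fin K → Finset (Fin N)} {m : ℕ} {r : Fin K → ℕ}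

/-- By Hall's theorem, the cutset conditions allow to match the message symbols with distinct
storage symbols that their users can access. -/
lemma exists_matching (hcut : ∀ S : Finset (Fin K), ∑ i ∈ S, r i ≤ m * (S.biUnion A).card) :
    ∃ f : (Σ k, Fin (r k)) → Fin N × Fin m, f.Injective ∧ ∀ i, (f i).1 ∈ A i.1 := by
  classical
  refine (Fintype.all_card_le_filter_rel_iff_exists_injective
    fun (i : Σ k, Fin (r k)) (c : Fin N × Fin m) => c.1 ∈ A i.1).1 fun T => ?_
  calc T.card ≤ ((T.image Sigma.fst).sigma fun _ => Finset.univ).card := by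
        refine Finset.card_le_card fun i hi => ?_
        simpa using ⟨i.2, hi⟩
    _ = ∑ k ∈ T.image Sigma.fst, r k := by simp
    _ ≤ m * ((T.image Sigma.fst).biUnion A).card := hcut _
    _ = (((T.image Sigma.fst).biUnion A) ×ˢ (Finset.univ : Finset (Fin m))).card := by
        simp [mul_comm]
    _ ≤ _ := by
        refine Finset.card_le_card fun c hc => ?_
        simpa using hc

/-- Over every large enough extension `E` of `k₀` there is a linear map from the storage contents to
the messages, in which user `k` only uses the nodes in `A k`, that is onto, and whose `k`-th
component stays onto after the nodes in `A l` are set to zero. -/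
lemma exists_decoding_matrix (k₀ : Type*) [Field k₀]
    (hdiff : ∀ k l : Fin K, l ≠ k → r k ≤ m * (A k \ A l).card)
    (hcut : ∀ S : Finset (Fin K), ∑ i ∈ S, r i ≤ m * (S.biUnion A).card) :
    ∃ D : ℕ, ∀ (E : Type) [Field E] [Fintype E] [Algebra k₀ E], D < Fintype.card E →
      ∃ C : Matrix (Σ k, Fin (r k)) (Fin N × Fin m) E,
        (∀ i c, c.1 ∉ A i.1 → C i c = 0) ∧
        (∀ w : (Σ k, Fin (r k)) → E, ∃ z : Fin N × Fin m → E, ∀ i, ∑ c, C i c * z c = w i) ∧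
        ∀ k l : Fin K, l ≠ k → ∀ w : Fin (r k) → E, ∃ z : Fin N × Fin m → E,
          (∀ c, c.1 ∈ A l → z c = 0) ∧ ∀ i, ∑ c, C ⟨k, i⟩ c * z c = w i := by
  classical
  let rel : (Σ k, Fin (r k)) → Fin N × Fin m → Prop := fun i c => c.1 ∈ A i.1
  obtain ⟨f, hf, hfA⟩ := exists_matching hcut
  have hpair : ∀ q : {q : Fin K × Fin K // q.2 ≠ q.1}, ∃ g : Fin (r q.1.1) → Fin N × Fin m,
      g.Injective ∧ ∀ i, (g i).1 ∈ A q.1.1 \ A q.1.2 := by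
    rintro ⟨⟨k, l⟩, hlk⟩
    obtain ⟨g⟩ := Function.Embedding.nonempty_of_card_le
      (α := Fin (r k)) (β := (A k \ A l : Finset (Fin N)) × Fin m)
      (by
        rw [Fintype.card_fin, Fintype.card_prod, Fintype.card_coe, Fintype.card_fin, mul_comm]
        exact hdiff k l hlk)
    refine ⟨fun i => ((g i).1, (g i).2), fun i j hij => ?_, fun i => (g i).1.2⟩
    refine g.injective (Prod.ext (Subtype.ext ?_) ?_)
    · exact (Prod.ext_iff.1 hij).1
    · exact (Prod.ext_iff.1 hij).2
  choose g hg hgA using hpair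
  let P₀ := ((genericMatrix k₀ rel).submatrix id f).det
  let P := fun q : {q : Fin K × Fin K // q.2 ≠ q.1} =>
    ((genericMatrix k₀ rel).submatrix (fun i => ⟨q.1.1, i⟩) (g q)).det
  have hP₀ : P₀ ≠ 0 := det_genericMatrix_submatrix_ne_zero k₀ Function.injective_id hf hfA
  have hP : ∀ q, P q ≠ 0 := fun q =>
    det_genericMatrix_submatrix_ne_zero k₀ sigma_mk_injective (hg q) fun i =>
      (Finset.mem_sdiff.1 (hgA q i)).1
  refine ⟨(P₀ * ∏ q, P q).totalDegree, fun E _ _ _ hE => ?_⟩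
  obtain ⟨x, hx⟩ := exists_aeval_ne_zero
    (mul_ne_zero hP₀ (Finset.prod_ne_zero_iff.2 fun q _ => hP q)) hE
  rw [map_mul, map_prod] at hx
  have hx₀ := left_ne_zero_of_mul hx
  have hx₁ := fun q => Finset.prod_ne_zero_iff.1 (right_ne_zero_of_mul hx) q (Finset.mem_univ q)
  let C := (genericMatrix k₀ rel).map (MvPolynomial.aeval x)
  refine ⟨C, fun i c hc => ?_, fun w => ?_, fun k l hlk w => ?_⟩
  · simp [C, genericMatrix, rel, hc]
  · obtain ⟨z, -, hz⟩ := exists_sum_mul_eq C id hf (by rwa [AlgHom.map_det] at hx₀) w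
    exact ⟨z, hz⟩
  · obtain ⟨z, hz0, hz⟩ := exists_sum_mul_eq C (fun i => ⟨k, i⟩) (hg ⟨(k, l), hlk⟩)
      (by have := hx₁ ⟨(k, l), hlk⟩; rwa [AlgHom.map_det] at this) w
    refine ⟨z, fun c hc => hz0 c ?_, hz⟩
    rintro ⟨i, rfl⟩
    exact (Finset.mem_sdiff.1 (hgA ⟨(k, l), hlk⟩ i)).2 hc

end Algebra

/-! ### Achievability -/

section Achievability

variable {K N : ℕ} {A : Fin K → Finset (Fin N)} {F : Type*} [Fintype F] [Nonempty F]
  {M : ℕ} {r : Fin K → ℕ}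

/-- What the users decode from the storage contents `y`. -/
def decodeAll (dec : (k : Fin K) → (A k → Fin M → F) → (Fin (r k) → F)) (y : Storage F N M) :
    Messages F r :=
  fun k => dec k (view (A k) y)

/-- Decoders give an error-free private scheme, with uniformly distributed contents, as soon as
the storage space has enough symmetries: for any two message tuples one that takes the contents
decoded to the first to contents decoded to the second, and for each pair of users `k ≠ l` the same
with the message of user `k` alone and without changing what user `l` reads. -/
lemma exists_scheme_of_symmetries (dec : (k : Fin K) → (A k → Fin M → F) → (Fin (r k) → F))
    (hall : ∀ w w' : Messages F r, ∃ σ : Storage F N M → Storage F N M, σ.Injective ∧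
      ∀ y, decodeAll dec y = w → decodeAll dec (σ y) = w')
    (hpair : ∀ k l : Fin K, k ≠ l → ∀ u u' : Fin (r k) → F,
      ∃ σ : Storage F N M → Storage F N M, σ.Injective ∧
        ∀ y, view (A l) (σ y) = view (A l) y ∧
          (decodeAll dec y k = u → decodeAll dec (σ y) k = u')) :
    ∃ s : Scheme A F M r, (∀ k, s.errorProb k = 0) ∧ s.IsPrivate := by
  classical
  let fib : Messages F r → Finset (Storage F N M) := fun w =>
    Finset.univ.filter fun y => decodeAll dec y = w
  have hle : ∀ w w', (fib w).card ≤ (fib w').card := by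
    intro w w'
    obtain ⟨σ, hσ, h⟩ := hall w w'
    refine Finset.card_le_card_of_injOn σ (fun y hy => ?_) hσ.injOn
    simpa [fib] using h y (by simpa [fib] using hy)
  have hne : ∀ w, (fib w).Nonempty := by
    intro w
    let y₀ : Storage F N M := Classical.arbitrary _
    have : 0 < (fib (decodeAll dec y₀)).card := Finset.card_pos.2 ⟨y₀, by simp [fib]⟩
    exact Finset.card_pos.1 (this.trans_le (hle _ _))
  let s : Scheme A F M r := ⟨fun w => PMF.uniformOfFinset (fib w) (hne w), dec⟩
  have hjoint : s.joint =
      (PMF.uniformOfFintype (Storage F N M)).map fun y => (decodeAll dec y, y) := by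
    have hcard : ∀ w, Fintype.card (Messages F r) * (fib w).card =
        Fintype.card (Storage F N M) := by
      intro w
      calc Fintype.card (Messages F r) * (fib w).card = ∑ w', (fib w').card := by
            rw [Finset.sum_congr rfl fun w' _ => le_antisymm (hle w' w) (hle w w')]
            simp
        _ = Fintype.card (Storage F N M) :=
            (Finset.card_eq_sum_card_fiberwise (f := decodeAll dec) (t := Finset.univ)
              (by simp)).symm
    ext ⟨w, y⟩
    rw [Scheme.joint, PMF.bind_apply, tsum_eq_single w, PMF.map_apply, PMF.map_apply,
      tsum_eq_single y, tsum_eq_single y]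
    · by_cases h : decodeAll dec y = w
      · have hmem : y ∈ fib w := by simp [fib, h]
        simp only [s, h, if_true, PMF.uniformOfFintype_apply,
          PMF.uniformOfFinset_apply_of_mem (hne w) hmem, ← hcard w]
        push_cast
        rw [ENNReal.mul_inv (.inr (ENNReal.natCast_ne_top _)) (.inl (ENNReal.natCast_ne_top _))]
      · have hmem : y ∉ fib w := by simp [fib, h]
        simp [s, hmem, Ne.symm h]
    · intro y' hy'
      simp [Ne.symm hy']
    · intro y' hy'
      simp [Ne.symm hy']
    · intro w' hw'
      simp [PMF.map_apply, Ne.symm hw']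
  refine ⟨s, fun k => ?_, fun k l hkl => ?_⟩
  · change prob s.joint _ = 0
    rw [hjoint, prob_map]
    have : (fun y => (decodeAll dec y, y)) ⁻¹'
        {p : Messages F r × Storage F N M | s.dec k (view (A k) p.2) ≠ p.1 k} = ∅ := by
      ext y
      simp [s, decodeAll]
    rw [this, prob_uniformOfFintype]
    simp
  · refine (entropy_eq_condEntropy_iff _ _ _).2 (indep_of_joint_const _ _ _ ?_)
    suffices h : ∀ (u u' : Fin (r l) → F) (v : A k → Fin M → F),
        prob s.joint ({p | p.1 l = u} ∩ {p | view (A k) p.2 = v}) ≤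
          prob s.joint ({p | p.1 l = u'} ∩ {p | view (A k) p.2 = v}) from
      fun u u' v => le_antisymm (h u u' v) (h u' u v)
    intro u u' v
    obtain ⟨σ, hσ, h⟩ := hpair l k hkl.symm u u'
    rw [hjoint, prob_map, prob_map, prob_uniformOfFintype, prob_uniformOfFintype]
    gcongr ?_ / _
    refine Nat.cast_le.2 (Nat.card_le_card_of_injective
      (fun y => ⟨σ y.1, (h y.1).2 y.2.1, (h y.1).1.trans y.2.2⟩) fun y y' hy => ?_)
    exact Subtype.ext (hσ (congrArg Subtype.val hy))

/-- A linear code over a field `E` with `|F| ^ n` elements gives an error-free private scheme over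
`F`. Only cardinalities matter: symbols of `E` are written as `n` symbols of `F` in any way. -/
lemma exists_scheme_of_matrix {E : Type*} [Field E] [Fintype E] {n m : ℕ} {r : Fin K → ℕ}
    (hE : Fintype.card E = Fintype.card F ^ n)
    (C : Matrix (Σ k, Fin (r k)) (Fin N × Fin m) E)
    (hC : ∀ i c, c.1 ∉ A i.1 → C i c = 0)
    (hall : ∀ w : (Σ k, Fin (r k)) → E, ∃ z : Fin N × Fin m → E, ∀ i, ∑ c, C i c * z c = w i)
    (hpair : ∀ k l : Fin K, l ≠ k → ∀ w : Fin (r k) → E, ∃ z : Fin N × Fin m → E,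
      (∀ c, c.1 ∈ A l → z c = 0) ∧ ∀ i, ∑ c, C ⟨k, i⟩ c * z c = w i) :
    ∃ s : Scheme A F (n * m) fun k => n * r k, (∀ k, s.errorProb k = 0) ∧ s.IsPrivate := by
  classical
  have e : ∀ a : ℕ, Nonempty ((Fin a → E) ≃ (Fin (n * a) → F)) := fun a =>
    Fintype.card_eq.1 (by simp [hE, pow_mul])
  let eV : (Fin m → E) ≃ (Fin (n * m) → F) := (e m).some
  let eU : ∀ k, (Fin (r k) → E) ≃ (Fin (n * r k) → F) := fun k => (e (r k)).some
  -- The decoder of user `k` multiplies by its rows of `C`; the nodes outside `A k` count as zero.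
  let dec : (k : Fin K) → (A k → Fin (n * m) → F) → (Fin (n * r k) → F) := fun k v =>
    eU k fun i => ∑ c : Fin N × Fin m, C ⟨k, i⟩ c *
      if h : c.1 ∈ A k then eV.symm (v ⟨c.1, h⟩) c.2 else 0
  have hdec : ∀ y k, decodeAll dec y k =
      eU k fun i => ∑ c : Fin N × Fin m, C ⟨k, i⟩ c * eV.symm (y c.1) c.2 := by
    intro y k
    simp only [decodeAll, dec]
    congr 1
    funext i
    refine Finset.sum_congr rfl fun c _ => ?_
    by_cases h : c.1 ∈ A k
    · simp [h, view]
    · simp [h, hC ⟨k, i⟩ c h]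
  -- The symmetries are the translations of the storage space.
  let shift : (Fin N × Fin m → E) → Storage F N (n * m) → Storage F N (n * m) := fun z y a =>
    eV (eV.symm (y a) + fun b => z (a, b))
  have hshift : ∀ z, (shift z).Injective := by
    intro z y y' h
    funext a
    have := congrFun h a
    simpa [shift] using this
  have hdec_shift : ∀ z y k, (eU k).symm (decodeAll dec (shift z y) k) =
      (eU k).symm (decodeAll dec y k) + fun i => ∑ c, C ⟨k, i⟩ c * z c := by
    intro z y k
    funext i
    simp [hdec, shift, mul_add, Finset.sum_add_distrib]
  refine exists_scheme_of_symmetries dec (fun w w' => ?_) fun k l hkl u u' => ?_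
  · obtain ⟨z, hz⟩ := hall fun i => (eU i.1).symm (w' i.1) i.2 - (eU i.1).symm (w i.1) i.2
    refine ⟨shift z, hshift z, ?_⟩
    rintro y rfl
    funext k
    apply (eU k).symm.injective
    rw [hdec_shift]
    funext i
    simp [hz]
  · obtain ⟨z, hz0, hz⟩ := hpair k l hkl.symm fun i => (eU k).symm u' i - (eU k).symm u i
    refine ⟨shift z, hshift z, fun y => ⟨?_, ?_⟩⟩
    · funext a
      have : (fun b => z (a.1, b)) = 0 := funext fun b => hz0 _ a.2
      simp [view, shift, this]
    · rintro rfl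
      apply (eU k).symm.injective
      rw [hdec_shift]
      funext i
      simp [hz]

/-- Rational points of the region are achieved without errors, over field extensions of growing
degree. -/
lemma achievable_of_le {F : Type*} [Field F] [Fintype F] {m : ℕ} (hm : 0 < m) {r : Fin K → ℕ}
    (hdiff : ∀ k l : Fin K, l ≠ k → r k ≤ m * (A k \ A l).card)
    (hcut : ∀ S : Finset (Fin K), ∑ i ∈ S, r i ≤ m * (S.biUnion A).card) :
    Achievable A F fun k => (r k : ℝ) / m := by
  obtain ⟨p, hchar⟩ := CharP.exists F
  obtain ⟨d, hp, hd⟩ := FiniteField.card F p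
  have : Fact p.Prime := ⟨hp⟩
  obtain ⟨D, hD⟩ := exists_decoding_matrix (ZMod p) hdiff hcut
  have hs : ∀ j : ℕ, ∃ s : Scheme A F ((j + D + 1) * m) fun k => (j + D + 1) * r k,
      (∀ k, s.errorProb k = 0) ∧ s.IsPrivate := by
    intro j
    have := Fintype.ofFinite (GaloisField p (d * (j + D + 1)))
    have hE : Fintype.card (GaloisField p (d * (j + D + 1))) =
        Fintype.card F ^ (j + D + 1) := by
      rw [← Nat.card_eq_fintype_card, GaloisField.card p _ (by positivity), hd, pow_mul]
    have hlt : D < Fintype.card (GaloisField p (d * (j + D + 1))) := by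
      rw [hE]
      have := Nat.lt_pow_self (n := j + D + 1) (Fintype.one_lt_card (α := F))
      omega
    obtain ⟨C, hC, hall, hpair⟩ := hD _ hlt
    exact exists_scheme_of_matrix hE C hC hall hpair
  choose s herr hpriv using hs
  refine ⟨fun j => (j + D + 1) * m, fun j k => (j + D + 1) * r k, s, fun j => by positivity, ?_,
    fun j k => ?_, fun k => ?_, hpriv⟩
  · refine tendsto_atTop_mono (fun j => ?_) tendsto_id
    exact le_trans (by simp only [id]; omega) (Nat.le_mul_of_pos_right _ hm)
  · push_cast
    exact mul_div_mul_left _ _ (by positivity)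
  · simpa only [herr] using tendsto_const_nhds

/-- The region is closed under decreasing the rates, so rounding down gives rational points. -/
lemma rateRegion_subset_capacityRegion (A : Fin K → Finset (Fin N)) (F : Type*) [Field F]
    [Fintype F] : rateRegion A ⊆ capacityRegion A F := by
  rintro R ⟨hR0, hR1, hR2⟩
  refine mem_closure_of_tendsto (b := atTop)
    (f := fun (n : ℕ) k => (⌊R k * ((n + 1 : ℕ) : ℝ)⌋₊ : ℝ) / ((n + 1 : ℕ) : ℝ)) ?_ ?_
  · refine tendsto_pi_nhds.2 fun k => ?_
    exact (tendsto_nat_floor_mul_div_atTop (hR0 k)).comp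
      (tendsto_natCast_atTop_atTop.comp (tendsto_add_atTop_nat 1))
  · refine Eventually.of_forall fun n => ?_
    have hfloor : ∀ k, (⌊R k * ((n + 1 : ℕ) : ℝ)⌋₊ : ℝ) ≤ R k * ((n + 1 : ℕ) : ℝ) := fun k =>
      Nat.floor_le (mul_nonneg (hR0 k) (by positivity))
    refine achievable_of_le (Nat.succ_pos n) (fun k l hlk => ?_) fun S => ?_
    · have h : (⌊R k * ((n + 1 : ℕ) : ℝ)⌋₊ : ℝ) ≤ ((n + 1 : ℕ) : ℝ) * (A k \ A l).card := by
        rw [mul_comm _ (((A k \ A l).card : ℕ) : ℝ)]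
        exact (hfloor k).trans (by gcongr; exact hR1 k l hlk)
      exact_mod_cast h
    · have h : ∑ k ∈ S, (⌊R k * ((n + 1 : ℕ) : ℝ)⌋₊ : ℝ) ≤
          ((n + 1 : ℕ) : ℝ) * (S.biUnion A).card := by
        refine (Finset.sum_le_sum fun k _ => hfloor k).trans ?_
        rw [← Finset.sum_mul, mul_comm]
        gcongr
        exact hR2 S
      exact_mod_cast h

end Achievability
end

end DMUSS

theorem theorem1 (K N : ℕ) (A : Fin K → Finset (Fin N)) (F : Type*) [Field F] [Fintype F] :
    DMUSS.capacityRegion A F = convexHull ℝ (DMUSS.rateRegion A) ∧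
      convexHull ℝ (DMUSS.rateRegion A) = DMUSS.rateRegion A := by
  have hconv := (DMUSS.convex_rateRegion A).convexHull_eq
  refine ⟨?_, hconv⟩
  rw [hconv]
  refine Set.Subset.antisymm ?_ (DMUSS.rateRegion_subset_capacityRegion A F)
  exact closure_minimal (fun R hR => hR.mem_rateRegion Fintype.one_lt_card)
    (DMUSS.isClosed_rateRegion A)
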